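/- Let $p$ be an odd prime. For a subgroup $H$ of a group $G$, let $H^{p}$ denote the subgroup generated by the $p$-th powers of the elements of $H$. A finite $p$-group $G$ is called powerfully nilpotent if it is powerful, that is $[G,G]\le G^{p}$, and has a chain of subgroups $\{1\}=H_0\le H_1\le\cdots\le H_m=G$ with $[H_i,G]\le H_{i-1}^{p}$ for $i=1,\dots,m$. For $n\ge 2$ let $f(n)$ be the number of isomorphism classes of powerfully nilpotent groups of exponent exactly $p^{2}$ and order $p^{n}$. Then $$f(n)=p^{\alpha n^{3}+o(n^{3})}\quad\text{as } n\to\infty,\qquad \alpha=\frac{9+4\sqrt{2}}{294};$$ that is, there is a function $\varepsilon:\mathbb{N}\to\mathbb{R}$ (which may depend on $p$) with $\varepsilon(n)/n^{3}\to 0$ and $f(n)=p^{\alpha n^{3}+\varepsilon(n)}$ for all $n\ge 2$. -/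

import Mathlib

/-- The subgroup `H ^ m` of `G` generated by all the `m`-th powers of elements of `H`. -/
def powSubgroup {G : Type*} [Group G] (H : Subgroup G) (m : ℕ) : Subgroup G :=
  Subgroup.closure {g : G | ∃ x ∈ H, g = x ^ m}

/-- A finite `p`-group `G` is powerful if `[G, G] ≤ G ^ p` when `p` is odd, and
`[G, G] ≤ G ^ 4` when `p = 2`. -/
def IsPowerfulPGroup (p : ℕ) (G : Type*) [Group G] : Prop :=
  Finite G ∧ IsPGroup p G ∧
    ⁅(⊤ : Subgroup G), (⊤ : Subgroup G)⁆ ≤ powSubgroup (⊤ : Subgroup G) (if p = 2 then 4 else p)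

/-- `H 0 ≤ H 1 ≤ ⋯ ≤ H m` is a powerfully central chain of subgroups of `G`: one has
`[H (i + 1), G] ≤ (H i) ^ p` for all `i < m`. The values `H i` with `i > m` play no role. -/
def IsPowerfullyCentralChain (p : ℕ) {G : Type*} [Group G] (m : ℕ) (H : ℕ → Subgroup G) : Prop :=
  ∀ i < m, H i ≤ H (i + 1) ∧ ⁅H (i + 1), (⊤ : Subgroup G)⁆ ≤ powSubgroup (H i) p

/-- A powerful `p`-group `G` is powerfully nilpotent if it has a powerfully central chain
`{1} = H 0 ≤ H 1 ≤ ⋯ ≤ H m = G`. -/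
def IsPowerfullyNilpotent (p : ℕ) (G : Type*) [Group G] : Prop :=
  IsPowerfulPGroup p G ∧
    ∃ (m : ℕ) (H : ℕ → Subgroup G), H 0 = ⊥ ∧ H m = ⊤ ∧ IsPowerfullyCentralChain p m H

/-- The group structures on the standard set with `p ^ n` elements for which the resulting group
is powerfully nilpotent of exponent (exactly) `p ^ 2`. Every such group of order `p ^ n` is
isomorphic to at least one of these. -/
abbrev PNStructure (p n : ℕ) : Type :=
  {S : Group (Fin (p ^ n)) //
    @IsPowerfullyNilpotent p (Fin (p ^ n)) S ∧
      @Monoid.exponent (Fin (p ^ n)) S.toMonoid = p ^ 2}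

/-- Two group structures are equivalent if the resulting groups are isomorphic. -/
def pnSetoid (p n : ℕ) : Setoid (PNStructure p n) where
  r S T := Nonempty (@MulEquiv (Fin (p ^ n)) (Fin (p ^ n)) S.1.toMul T.1.toMul)
  iseqv :=
    { refl := fun S => ⟨@MulEquiv.refl _ S.1.toMul⟩
      symm := fun {S T} h => h.elim fun e => ⟨@MulEquiv.symm _ _ S.1.toMul T.1.toMul e⟩
      trans := fun {S T U} h k => h.elim fun e => k.elim fun f =>
        ⟨@MulEquiv.trans _ _ _ S.1.toMul T.1.toMul U.1.toMul e f⟩ }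

/-- The number of powerfully nilpotent groups of exponent `p ^ 2` and order `p ^ n`, up to
isomorphism. -/
noncomputable def numPN (p n : ℕ) : ℕ :=
  Nat.card (Quotient (pnSetoid p n))

/-!
The growth of the number of powerfully nilpotent groups of exponent `p ^ 2` is found by counting
structure constants.

In such a group `G` the `p`-th powers are central (`commute_pow_of_chain`, by induction along the
chain), so that `G` has class at most two, and, as `p` is odd, `x ↦ x ^ p` is a homomorphism
(`isPowCentral_of_chain`). Put `|G ^ p| = p ^ s` and `|G / G ^ p| = p ^ r`, with `r + s = n` and
`s ≤ r`. Refining the chain to a complete flag gives generators `x 0, …, x (r - 1)` modulo `G ^ p`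
such that `⁅x i, x j⁆`, for `i < j`, lies in the span of the `x k ^ p` with `k < i`
(`exists_adapted_tuple`). In coordinates on `G ^ p` the `p`-th powers and the commutators of the
generators are structure constants, and they determine `G` (`Realizes.nonempty_mulEquiv`).

There are at most `p ^ (r * s)` possibilities for the `p`-th powers. Given these, the commutator
`⁅x i, x j⁆` ranges over a space of dimension at most `min i s`, so that there are at most `p ^ T`
possibilities for the commutators, where `T = numTriples r s` is the sum of `min i s` over the pairs
`i < j < r` (`finite_quotient_and_numPN_le`). Conversely, each choice of triangular commutators over
the standard `p`-th powers is realized by a twisted multiplication on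
`(ℤ/p²) ^ s × (ℤ/p) ^ (r - s)` (`exists_twisted_group`), and at most `(p ^ n) ^ r` of these choices
give isomorphic groups, since the images of the generators determine the choice
(`pow_numTriples_le`). Hence `log_p` of the number of groups is, up to `O(n ^ 2)`, the maximum of
`T` over `2 * s ≤ n`.

Counting triples `k < i < j < r` with `k < s` gives `T = r.choose 3 - (r - s).choose 3`, which is
`((n - s) ^ 3 - (n - 2 * s) ^ 3) / 6` up to `O(n ^ 2)`. By `growth_identity` the maximum of this
cubic on `0 ≤ s ≤ n / 2` is `(9 + 4 * √2) / 294 * n ^ 3`, attained at `s = (3 - √2) / 7 * n`.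
-/

section Groups

open Subgroup
open scoped commutatorElement

/-! ### Structure constants -/

/-- Pairwise commuting elements of order dividing `p`, `r` in number, generate at most `p ^ r`
elements. -/
theorem card_closure_range_le {Q : Type*} [Group Q] {p r : ℕ} (hp : 0 < p) (y : Fin r → Q)
    (hy : ∀ i j, Commute (y i) (y j)) (hyp : ∀ i, y i ^ p = 1) :
    Finite (closure (Set.range y)) ∧ Nat.card (closure (Set.range y)) ≤ p ^ r := by
  have hfin : ∀ i, Finite (zpowers (y i)) := fun i =>
    isOfFinOrder_iff_pow_eq_one.2 ⟨p, hp, hyp i⟩ |>.finite_zpowers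
  have hcomm : Pairwise fun i j => ∀ a b : Q, a ∈ zpowers (y i) → b ∈ zpowers (y j) →
      Commute a b := by
    rintro i j - a b ⟨k, rfl⟩ ⟨l, rfl⟩
    exact (hy i j).zpow_zpow k l
  have hr : closure (Set.range y) = (noncommPiCoprod hcomm).range := by
    rw [noncommPiCoprod_range]
    simp_rw [zpowers_eq_closure]
    rw [← Subgroup.closure_iUnion, Set.iUnion_singleton_eq_range]
  rw [hr]
  refine ⟨Set.finite_range (noncommPiCoprod hcomm), ?_⟩
  calc Nat.card (noncommPiCoprod hcomm).range ≤ Nat.card (∀ i, zpowers (y i)) :=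
        Nat.card_le_card_of_surjective _ (noncommPiCoprod hcomm).rangeRestrict_surjective
    _ = ∏ i, Nat.card (zpowers (y i)) := Nat.card_pi
    _ ≤ ∏ _i : Fin r, p := Finset.prod_le_prod' fun i _ => by
        rw [Nat.card_zpowers]; exact orderOf_le_of_pow_eq_one hp (hyp i)
    _ = p ^ r := by simp

/-- The group `G` carries the structure constants `(P, C)` over `𝔽_p`: there are elements
`x 0, …, x (r - 1)` and an embedding `ω` of `𝔽_p ^ s` into the centre of `G` such that `x i ^ p` has
coordinates `P i`, and `⁅x i, x j⁆`, for `i < j`, has coordinates `C j i`. That `G` is generated by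
the `x i` and the range of `ω` is not part of the definition. -/
structure Realizes (p : ℕ) {r s : ℕ} (P : Fin r → Fin s → ZMod p)
    (C : (j : Fin r) → Fin j → Fin s → ZMod p) {G : Type*} [Group G] (x : Fin r → G)
    (ω : Multiplicative (Fin s → ZMod p) →* G) : Prop where
  central : ∀ w g, Commute (ω w) g
  injective : Function.Injective ω
  pow_eq : ∀ i, x i ^ p = ω (.ofAdd (P i))
  commutator_eq : ∀ (j : Fin r) (i : Fin j), ⁅x ⟨i, i.2.trans j.2⟩, x j⁆ = ω (.ofAdd (C j i))

theorem Realizes.map {p r s : ℕ} {P : Fin r → Fin s → ZMod p}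
    {C : (j : Fin r) → Fin j → Fin s → ZMod p} {G G' : Type*} [Group G] [Group G']
    {x : Fin r → G} {ω : Multiplicative (Fin s → ZMod p) →* G} (h : Realizes p P C x ω)
    (e : G ≃* G') : Realizes p P C (fun i => e (x i)) (e.toMonoidHom.comp ω) where
  central w g := by
    have := (h.central w (e.symm g)).map e
    simpa using this
  injective := e.injective.comp h.injective
  pow_eq i := by simp [← h.pow_eq, map_pow]
  commutator_eq j i := by simp [← h.commutator_eq, map_commutatorElement]

/-- Groups of order `p ^ (r + s)` generated by realizations of the same structure constants are
isomorphic. The subgroup `D` of `G × G'` generated by the pairs `(x i, x' i)` and the graph `N` of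
`ω w ↦ ω' w` is the graph of an isomorphism: it projects onto both factors, and it is no larger than
either of them, because `D / N` is generated by `r` commuting elements of order dividing `p`. -/
theorem Realizes.nonempty_mulEquiv {p r s : ℕ} (hp : p.Prime) {P : Fin r → Fin s → ZMod p}
    {C : (j : Fin r) → Fin j → Fin s → ZMod p} {G G' : Type*} [Group G] [Group G']
    {x : Fin r → G} {ω : Multiplicative (Fin s → ZMod p) →* G} (h : Realizes p P C x ω)
    {x' : Fin r → G'} {ω' : Multiplicative (Fin s → ZMod p) →* G'} (h' : Realizes p P C x' ω')
    (hgen : closure (Set.range x) ⊔ ω.range = ⊤) (hgen' : closure (Set.range x') ⊔ ω'.range = ⊤)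
    (hG : Nat.card G = p ^ (r + s)) (hG' : Nat.card G' = p ^ (r + s)) :
    Nonempty (G ≃* G') := by
  have : NeZero p := ⟨hp.ne_zero⟩
  set N : Subgroup (G × G') := (ω.prod ω').range
  have hcen : N ≤ center (G × G') := by
    rintro _ ⟨w, rfl⟩
    exact mem_center_iff.2 fun g => Prod.ext (h.central w g.1).eq.symm (h'.central w g.2).eq.symm
  have hNn : N.Normal := ⟨fun a ha g => by
    rw [(mem_center_iff.1 (hcen ha) g), mul_inv_cancel_right]; exact ha⟩
  have hNcard : Nat.card N ≤ p ^ s := by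
    refine (Nat.card_le_card_of_surjective _ (ω.prod ω').rangeRestrict_surjective).trans ?_
    simp
  set z : Fin r → G × G' := fun i => (x i, x' i)
  set D : Subgroup (G × G') := closure (Set.range z) ⊔ N
  let q : G × G' →* (G × G') ⧸ N := QuotientGroup.mk' N
  -- Both the commutators and the `p`-th powers of the generating pairs lie in `N`, since they have
  -- the same coordinates in the two groups.
  have hcl : Finite (closure (Set.range (q ∘ z))) ∧
      Nat.card (closure (Set.range (q ∘ z))) ≤ p ^ r := by
    apply card_closure_range_le hp.pos
    · have key : ∀ (j : Fin r) (i : Fin j),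
          Commute ((q ∘ z) ⟨i, i.2.trans j.2⟩) ((q ∘ z) j) := by
        intro j i
        rw [← commutatorElement_eq_one_iff_commute, Function.comp, Function.comp,
          ← map_commutatorElement]
        refine (QuotientGroup.eq_one_iff _).2 ⟨.ofAdd (C j i), ?_⟩
        exact Prod.ext (h.commutator_eq j i).symm (h'.commutator_eq j i).symm
      intro i j
      rcases lt_trichotomy i j with hij | rfl | hij
      · exact key j ⟨i, hij⟩
      · exact Commute.refl _
      · exact (key i ⟨j, hij⟩).symm
    · intro i
      rw [Function.comp, ← map_pow]
      exact (QuotientGroup.eq_one_iff _).2 ⟨.ofAdd (P i),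
        Prod.ext (h.pow_eq i).symm (h'.pow_eq i).symm⟩
  have hDq : D.map q = closure (Set.range (q ∘ z)) := by
    have : N.map q = ⊥ := (Subgroup.map_eq_bot_iff _).2 (by simp [q])
    rw [Subgroup.map_sup, this, sup_bot_eq, MonoidHom.map_closure, ← Set.range_comp]
  have : Finite G := Nat.finite_of_card_ne_zero (by rw [hG]; exact pow_ne_zero _ hp.ne_zero)
  have : Finite G' := Nat.finite_of_card_ne_zero (by rw [hG']; exact pow_ne_zero _ hp.ne_zero)
  have hD : Nat.card D ≤ p ^ (r + s) := by
    have hND : N ≤ D := le_sup_right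
    have h1 : Nat.card D = Nat.card (D.map q) * Nat.card N := by
      rw [← relIndex_bot_left D, ← relIndex_mul_relIndex ⊥ N D bot_le hND, relIndex_bot_left,
        mul_comm]
      rw [← relIndex_ker, QuotientGroup.ker_mk']
    rw [h1, hDq, pow_add]
    exact Nat.mul_le_mul hcl.2 hNcard
  have hz : ∀ i, z i ∈ D := fun i => le_sup_left (a := closure (Set.range z))
    (subset_closure ⟨i, rfl⟩)
  have hw : ∀ w, (ω w, ω' w) ∈ D := fun w => le_sup_right (b := N) ⟨w, rfl⟩
  have s1 : Function.Surjective ((MonoidHom.fst G G').comp D.subtype) := by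
    rw [← MonoidHom.range_eq_top, eq_top_iff, ← hgen, sup_le_iff, closure_le]
    exact ⟨by rintro _ ⟨i, rfl⟩; exact ⟨⟨_, hz i⟩, rfl⟩,
      by rintro _ ⟨w, rfl⟩; exact ⟨⟨_, hw w⟩, rfl⟩⟩
  have s2 : Function.Surjective ((MonoidHom.snd G G').comp D.subtype) := by
    rw [← MonoidHom.range_eq_top, eq_top_iff, ← hgen', sup_le_iff, closure_le]
    exact ⟨by rintro _ ⟨i, rfl⟩; exact ⟨⟨_, hz i⟩, rfl⟩,
      by rintro _ ⟨w, rfl⟩; exact ⟨⟨_, hw w⟩, rfl⟩⟩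
  have b1 := s1.bijective_of_nat_card_le (hD.trans hG.ge)
  have b2 := s2.bijective_of_nat_card_le (hD.trans hG'.ge)
  exact ⟨(MulEquiv.ofBijective _ b1).symm.trans (MulEquiv.ofBijective _ b2)⟩

/-! ### Powers and commutators along a powerfully central chain -/

theorem pow_mem_powSubgroup {G : Type*} [Group G] {H : Subgroup G} (m : ℕ) {x : G} (hx : x ∈ H) :
    x ^ m ∈ powSubgroup H m :=
  subset_closure ⟨x, hx, rfl⟩

theorem powSubgroup_mono {G : Type*} [Group G] {H K : Subgroup G} (m : ℕ) (h : H ≤ K) :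
    powSubgroup H m ≤ powSubgroup K m :=
  Subgroup.closure_mono fun _ ⟨x, hx, hg⟩ => ⟨x, h hx, hg⟩

/-- The power formula in a group of nilpotency class two. -/
theorem mul_pow_of_central_commutator {G : Type*} [Group G] {x y c : G} (hc : ∀ g, Commute c g)
    (h : y * x = c * (x * y)) (k : ℕ) : (x * y) ^ k = c ^ k.choose 2 * (x ^ k * y ^ k) := by
  have h1 : ∀ k, y ^ k * x = c ^ k * (x * y ^ k) := by
    intro k
    induction k with
    | zero => simp
    | succ k ih =>
      calc y ^ (k + 1) * x = y ^ k * (y * x) := by rw [pow_succ, mul_assoc]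
        _ = y ^ k * c * (x * y) := by rw [h]; simp only [mul_assoc]
        _ = c * (y ^ k * x) * y := by rw [← (hc (y ^ k)).eq]; simp only [mul_assoc]
        _ = c ^ (k + 1) * (x * y ^ (k + 1)) := by
          rw [ih, pow_succ' c, pow_succ y]; simp only [mul_assoc]
  induction k with
  | zero => simp
  | succ k ih =>
    have h2 : (k + 1).choose 2 = k.choose 2 + k := by
      rw [Nat.choose_succ_succ' k 1, Nat.choose_one_right, add_comm]
    calc (x * y) ^ (k + 1) = c ^ k.choose 2 * (x ^ k * (y ^ k * x) * y) := by
          rw [pow_succ, ih]; simp only [mul_assoc]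
      _ = c ^ k.choose 2 * (x ^ k * c ^ k * x * y ^ k * y) := by
          rw [h1]; simp only [mul_assoc]
      _ = c ^ (k + 1).choose 2 * (x ^ (k + 1) * y ^ (k + 1)) := by
          rw [h2, pow_add, pow_succ x, pow_succ y, ← ((hc (x ^ k)).pow_left k).eq]
          simp only [mul_assoc]

/-- If the `p`-th powers of elements of `H` are central of order dividing `p`, so are all elements
of the subgroup that they generate. -/
theorem central_of_mem_powSubgroup {p : ℕ} {G : Type*} [Group G] {H : Subgroup G}
    (hpp : ∀ x ∈ H, (x ^ p) ^ p = 1) (hc : ∀ x ∈ H, ∀ g, Commute (x ^ p) g) :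
    ∀ z ∈ powSubgroup H p, z ^ p = 1 ∧ ∀ g, Commute z g := by
  intro z hz
  induction hz using closure_induction with
  | mem z hz =>
    obtain ⟨y, hy, rfl⟩ := hz
    exact ⟨hpp y hy, hc y hy⟩
  | one => simp
  | mul a b _ _ ha hb =>
    exact ⟨by rw [(ha.2 b).mul_pow, ha.1, hb.1, one_mul], fun g => (ha.2 g).mul_left (hb.2 g)⟩
  | inv a _ ha => exact ⟨by rw [inv_pow, ha.1, inv_one], fun g => (ha.2 g).inv_left⟩

/-- Along a powerfully central chain in a group of exponent dividing `p ^ 2`, the `p`-th powers are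
central: if this holds for `H i`, then commutators with `x ∈ H (i + 1)` lie in `(H i) ^ p`, so they
are central of order dividing `p`, and `x ^ p` commutes with everything. -/
theorem commute_pow_of_chain {p : ℕ} {G : Type*} [Group G] (hexp : ∀ x : G, x ^ p ^ 2 = 1)
    {m : ℕ} {H : ℕ → Subgroup G} (h0 : H 0 = ⊥) (hH : IsPowerfullyCentralChain p m H) :
    ∀ i ≤ m, ∀ x ∈ H i, ∀ g, Commute (x ^ p) g := by
  intro i
  induction i with
  | zero =>
    intro _ x hx g
    rw [h0, mem_bot] at hx
    simp [hx]
  | succ i ih =>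
    intro hi x hx g
    have key := central_of_mem_powSubgroup
      (fun y _ => by rw [← pow_mul, ← pow_two, hexp]) (ih (by omega))
    obtain ⟨h1, h2⟩ := key ⁅x, g⁆ ((hH i (by omega)).2 (commutator_mem_commutator hx (mem_top g)))
    have h3 : x * g = ⁅x, g⁆ * (g * x) := by rw [commutatorElement_def]; group
    have h5 : g⁻¹ * x * g = ⁅x, g⁆ * x := by
      rw [mul_assoc, h3, ← mul_assoc, ← (h2 g⁻¹).eq]; group
    have h6 : g⁻¹ * x ^ p * g = x ^ p := by
      have := conj_pow (i := p) (a := g⁻¹) (b := x)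
      rw [inv_inv, h5, (h2 x).mul_pow, h1, one_mul] at this
      exact this.symm
    show x ^ p * g = g * x ^ p
    nth_rw 2 [← h6]
    group

/-- Taking `p`-th powers is an endomorphism of `G` whose image is central and killed by it. -/
structure IsPowCentral (p : ℕ) (G : Type*) [Group G] : Prop where
  central : ∀ x g : G, Commute (x ^ p) g
  pow_pow : ∀ x : G, (x ^ p) ^ p = 1
  mul_pow : ∀ x y : G, (x * y) ^ p = x ^ p * y ^ p

/-- This is where `p` is odd: the commutator in the formula for `(x * y) ^ p` appears to the power
`p.choose 2`, a multiple of `p`. -/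
theorem isPowCentral_of_chain {p : ℕ} (hp : p.Prime) (hodd : Odd p) {G : Type*} [Group G]
    (hexp : ∀ x : G, x ^ p ^ 2 = 1) {m : ℕ} {H : ℕ → Subgroup G} (h0 : H 0 = ⊥) (hm : H m = ⊤)
    (hH : IsPowerfullyCentralChain p m H)
    (hpow : ⁅(⊤ : Subgroup G), (⊤ : Subgroup G)⁆ ≤ powSubgroup (⊤ : Subgroup G) p) :
    IsPowCentral p G := by
  have hc : ∀ x g : G, Commute (x ^ p) g := fun x =>
    commute_pow_of_chain hexp h0 hH m le_rfl x (hm ▸ mem_top x)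
  have hpp : ∀ x : G, (x ^ p) ^ p = 1 := fun x => by rw [← pow_mul, ← pow_two, hexp]
  refine ⟨hc, hpp, fun x y => ?_⟩
  have key := central_of_mem_powSubgroup (H := ⊤) (fun y _ => hpp y) (fun y _ => hc y)
  obtain ⟨h1, h2⟩ := key ⁅y, x⁆ (hpow (commutator_mem_commutator (mem_top y) (mem_top x)))
  rw [mul_pow_of_central_commutator (c := ⁅y, x⁆) h2 (by rw [commutatorElement_def]; group)]
  have h2p : 2 < p := lt_of_le_of_ne hp.two_le (by rintro rfl; exact absurd hodd (by decide))
  obtain ⟨k, hk⟩ := hp.dvd_choose_self (k := 2) (by norm_num) h2p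
  rw [hk, pow_mul, h1, one_pow, one_mul]

/-- The endomorphism `x ↦ x ^ p`. -/
def IsPowCentral.powHom {p : ℕ} {G : Type*} [Group G] (h : IsPowCentral p G) : G →* G where
  toFun x := x ^ p
  map_one' := one_pow p
  map_mul' := h.mul_pow

theorem IsPowCentral.powSubgroup_eq_map {p : ℕ} {G : Type*} [Group G] (h : IsPowCentral p G)
    (K : Subgroup G) : powSubgroup K p = K.map h.powHom := by
  have : {g : G | ∃ x ∈ K, g = x ^ p} = (K.map h.powHom : Subgroup G) := by
    ext g
    simp only [Set.mem_ofPred_eq, SetLike.mem_coe, mem_map, eq_comm (a := g)]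
    rfl
  rw [powSubgroup, this, closure_eq]

/-! ### Generators adapted to a chain -/

/-- A greedy choice of elements `x 0, x 1, …` that are adapted to a powerfully central chain:
`⁅x j, G⁆` lies in the subgroup generated by the `x k ^ p` with `k < j`, and every `x j` enlarges
by a factor of at least `p` the subgroup `K` generated by `G ^ p` and the previous elements, until
`K` is all of `G`. The next element is any member outside `K` of the first term of the chain that
is not contained in `K`. -/
theorem exists_adapted_tuple {p n s : ℕ} (hp : p.Prime) {G : Type*} [Group G]
    (hcard : Nat.card G = p ^ n) (hG : IsPowCentral p G) (hs : Nat.card hG.powHom.range = p ^ s)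
    {m : ℕ} {H : ℕ → Subgroup G} (h0 : H 0 = ⊥) (hm : H m = ⊤)
    (hH : IsPowerfullyCentralChain p m H) (i : ℕ) :
    ∃ x : ℕ → G,
      (∀ j < i, ∀ g, ⁅x j, g⁆ ∈ closure ((fun k => x k ^ p) '' Set.Iio j)) ∧
      p ^ min (s + i) n ≤ Nat.card ↥(closure (x '' Set.Iio i) ⊔ hG.powHom.range) := by
  have hfin : Finite G := Nat.finite_of_card_ne_zero (by rw [hcard]; exact pow_ne_zero _ hp.ne_zero)
  induction i with
  | zero =>
    refine ⟨fun _ => 1, by simp, ?_⟩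
    have : Set.Iio 0 = (∅ : Set ℕ) := by ext; simp
    simp only [this, Set.image_empty, Subgroup.closure_empty, bot_sup_eq, hs]
    exact Nat.pow_le_pow_right hp.pos (min_le_left _ _)
  | succ i ih =>
    obtain ⟨x, hx, hc⟩ := ih
    set K := closure (x '' Set.Iio i) ⊔ hG.powHom.range with hK
    -- It suffices to find the next member of the tuple.
    suffices hz : ∃ z : G, (∀ g, ⁅z, g⁆ ∈ closure ((fun k => x k ^ p) '' Set.Iio i)) ∧
        (K ≠ ⊤ → z ∉ K) by
      obtain ⟨z, hz1, hz2⟩ := hz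
      have hxk : ∀ k < i, Function.update x i z k = x k := fun k hk =>
        Function.update_of_ne hk.ne _ _
      refine ⟨Function.update x i z, ?_, ?_⟩
      · intro j hj g
        have e : (fun k => Function.update x i z k ^ p) '' Set.Iio j =
            (fun k => x k ^ p) '' Set.Iio j :=
          Set.image_congr fun k hk => by rw [hxk k (by simp at hk; omega)]
        rw [e]
        rcases (Nat.lt_succ_iff_lt_or_eq.1 hj) with hj | rfl
        · rw [hxk j hj]; exact hx j hj g
        · rw [Function.update_self]; exact hz1 g
      · set K' := closure (Function.update x i z '' Set.Iio (i + 1)) ⊔ hG.powHom.range with hK'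
        have hKK' : K ≤ K' := by
          refine sup_le_sup_right (Subgroup.closure_mono ?_) _
          rintro _ ⟨k, hk, rfl⟩
          exact ⟨k, Set.mem_Iio.2 (by simp at hk; omega), hxk k hk⟩
        have hzK' : z ∈ K' := le_sup_left (a := closure (Function.update x i z '' Set.Iio (i + 1)))
          (subset_closure ⟨i, by simp, Function.update_self ..⟩)
        by_cases hKt : K = ⊤
        · have : K' = ⊤ := top_le_iff.1 (hKt ▸ hKK')
          rw [this, card_top, hcard]
          exact Nat.pow_le_pow_right hp.pos (min_le_right _ _)
        · obtain ⟨a, -, ha⟩ := (Nat.dvd_prime_pow hp).1 (hcard ▸ card_subgroup_dvd_card K)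
          obtain ⟨b, -, hb⟩ := (Nat.dvd_prime_pow hp).1 (hcard ▸ card_subgroup_dvd_card K')
          have hab : a < b := by
            by_contra hba
            have := eq_of_le_of_card_ge hKK' (by
              rw [ha, hb]; exact Nat.pow_le_pow_right hp.pos (not_lt.1 hba))
            exact hz2 hKt (this ▸ hzK')
          rw [ha] at hc
          rw [hb]
          have := (Nat.pow_le_pow_iff_right hp.one_lt).1 hc
          exact Nat.pow_le_pow_right hp.pos (by omega)
    by_cases hKt : K = ⊤
    · exact ⟨1, fun g => by simp, fun h => absurd hKt h⟩
    have hex : ∃ l, ¬ H l ≤ K := ⟨m, by rwa [hm, top_le_iff]⟩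
    classical
    obtain ⟨z, hzH, hzK⟩ := SetLike.not_le_iff_exists.1 (Nat.find_spec hex)
    refine ⟨z, fun g => ?_, fun _ => hzK⟩
    obtain ⟨l, hl⟩ : ∃ l, Nat.find hex = l + 1 := Nat.exists_eq_succ_of_ne_zero (by
      intro h
      rw [h, h0, mem_bot] at hzH
      exact hzK (hzH ▸ one_mem K))
    have hlm : l < m := by
      have : Nat.find hex ≤ m := Nat.find_min' hex (by rwa [hm, top_le_iff])
      omega
    have hlK : H l ≤ K := not_not.1 (Nat.find_min hex (by omega))
    have h1 : ⁅z, g⁆ ∈ powSubgroup K p := powSubgroup_mono p hlK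
      ((hH l hlm).2 (commutator_mem_commutator (hl ▸ hzH) (mem_top g)))
    have h2 : hG.powHom.range.map hG.powHom = ⊥ := by
      rw [eq_bot_iff]
      rintro _ ⟨_, ⟨y, rfl⟩, rfl⟩
      exact mem_bot.2 (hG.pow_pow y)
    rw [hG.powSubgroup_eq_map, hK, Subgroup.map_sup, h2, sup_bot_eq, MonoidHom.map_closure,
      ← Set.image_comp] at h1
    exact h1

/-- An abelian group of exponent `p` and order `p ^ s` has coordinates in `𝔽_p`. -/
theorem nonempty_mulEquiv_of_pow_eq_one {p s : ℕ} (hp : p.Prime) {A : Type*} [CommGroup A]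
    (hA : ∀ a : A, a ^ p = 1) (hcard : Nat.card A = p ^ s) :
    Nonempty (Multiplicative (Fin s → ZMod p) ≃* A) := by
  have : Fact p.Prime := ⟨hp⟩
  have : Finite A := Nat.finite_of_card_ne_zero (by rw [hcard]; exact pow_ne_zero _ hp.ne_zero)
  let _ : Module (ZMod p) (Additive A) := AddCommGroup.zmodModule (n := p) fun a =>
    Additive.toMul.injective (hA a.toMul)
  have : Module.Finite (ZMod p) (Additive A) := Module.Finite.of_finite
  have hrank : Module.finrank (ZMod p) (Additive A) = s := by
    have h1 : Nat.card (Additive A) = p ^ s := hcard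
    rw [Module.natCard_eq_pow_finrank (K := ZMod p), Nat.card_zmod] at h1
    exact Nat.pow_right_injective hp.two_le h1
  exact ⟨AddEquiv.toMultiplicativeLeft
    (Module.finBasisOfFinrankEq (ZMod p) (Additive A) hrank).equivFun.symm.toAddEquiv⟩

/-- A powerfully nilpotent group of exponent `p ^ 2` and order `p ^ n`, with `|G ^ p| = p ^ s`, has
structure constants of triangular shape: `C j i` lies in the span of the `P k` with `k < i`. As
`x ↦ x ^ p` maps `G / G ^ p` onto `G ^ p`, moreover `2 * s ≤ n`. -/
theorem exists_realizes {p n : ℕ} (hp : p.Prime) (hodd : Odd p) {G : Type*} [Group G]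
    (hcard : Nat.card G = p ^ n) (hG : IsPowerfullyNilpotent p G)
    (hexp : Monoid.exponent G = p ^ 2) :
    ∃ s, 2 * s ≤ n ∧ ∃ (P : Fin (n - s) → Fin s → ZMod p)
      (C : (j : Fin (n - s)) → Fin j → Fin s → ZMod p) (x : Fin (n - s) → G)
      (ω : Multiplicative (Fin s → ZMod p) →* G),
      Realizes p P C x ω ∧ closure (Set.range x) ⊔ ω.range = ⊤ ∧
      ∀ (j : Fin (n - s)) (i : Fin j), C j i ∈ Submodule.span (ZMod p)
        (Set.range fun k : Fin (i : ℕ) => P ⟨k, k.2.trans (i.2.trans j.2)⟩) := by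
  have : Fact p.Prime := ⟨hp⟩
  obtain ⟨⟨hfin, -, hpow⟩, m, H, h0, hm, hH⟩ := hG
  have hp2 : p ≠ 2 := by rintro rfl; exact absurd hodd (by decide)
  rw [if_neg hp2] at hpow
  have hc := isPowCentral_of_chain hp hodd (fun x => hexp ▸ Monoid.pow_exponent_eq_one x) h0 hm hH
    hpow
  set W := hc.powHom.range with hW
  obtain ⟨s, hsn, hs⟩ := (Nat.dvd_prime_pow hp).1 (hcard ▸ card_subgroup_dvd_card W)
  have h2s : 2 * s ≤ n := by
    have h1 : W ≤ hc.powHom.ker := by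
      rintro _ ⟨y, rfl⟩
      exact hc.pow_pow y
    have h2 : Nat.card W ∣ W.index := by
      rw [hW, ← index_ker]
      exact index_dvd_of_le h1
    have h3 : Nat.card W * Nat.card W ∣ p ^ n := by
      rw [← hcard, ← card_mul_index W]
      exact mul_dvd_mul_left _ h2
    rw [hs, ← pow_add, Nat.pow_dvd_pow_iff_le_right hp.one_lt] at h3
    omega
  obtain ⟨x, hx, hxc⟩ := exists_adapted_tuple hp hcard hc hs h0 hm hH (n - s)
  -- Coordinates on the subgroup of `p`-th powers.
  let _ : CommGroup W := { (inferInstance : Group W) with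
    mul_comm := by
      rintro ⟨_, a, rfl⟩ b
      exact Subtype.ext (hc.central a b) }
  obtain ⟨e⟩ := nonempty_mulEquiv_of_pow_eq_one (A := W) hp (by
    rintro ⟨_, a, rfl⟩
    exact Subtype.ext (hc.pow_pow a)) hs
  have hcomm : ∀ (j : Fin (n - s)) (i : Fin j), ⁅x i, x j⁆ ∈ W := fun j i => by
    have h := hpow (commutator_mem_commutator (mem_top (x i)) (mem_top (x j)))
    rw [hc.powSubgroup_eq_map] at h
    exact map_le_range _ _ h
  have hgen : closure (x '' Set.Iio (n - s)) ⊔ W = ⊤ := by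
    have := hfin
    refine eq_top_of_card_eq _ (le_antisymm (card_le_card_group _) ?_)
    have hmin : min (s + (n - s)) n = n := by omega
    rw [hmin] at hxc
    rwa [hcard]
  let P : Fin (n - s) → Fin s → ZMod p := fun i => (e.symm ⟨x i ^ p, x i, rfl⟩).toAdd
  refine ⟨s, h2s, P, fun j i => (e.symm ⟨⁅x i, x j⁆, hcomm j i⟩).toAdd, fun i => x i,
    W.subtype.comp e.toMonoidHom, ⟨?_, ?_, ?_, ?_⟩, ?_, ?_⟩
  · intro w g
    obtain ⟨a, ha⟩ := (e w).2
    change Commute (e w : G) g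
    rw [← ha]
    exact hc.central a g
  · exact W.subtype_injective.comp e.injective
  · intro i
    simp [P]
  · intro j i
    simp
  · rw [← hgen]
    congr 2
    · ext g
      simp only [Set.mem_range, Set.mem_image, Set.mem_Iio]
      exact ⟨fun ⟨y, hy⟩ => ⟨y, y.2, hy⟩, fun ⟨y, hy, h⟩ => ⟨⟨y, hy⟩, h⟩⟩
    · rw [MonoidHom.range_comp, MonoidHom.range_eq_top.2 e.surjective, ← MonoidHom.range_eq_map,
        range_subtype]
  · intro j i
    set S := Submodule.span (ZMod p)
      (Set.range fun k : Fin (i : ℕ) => P ⟨k, k.2.trans (i.2.trans j.2)⟩) with hS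
    suffices h : ∀ g ∈ closure ((fun k => x k ^ p) '' Set.Iio (i : ℕ)), ∀ hg : g ∈ W,
        (e.symm ⟨g, hg⟩).toAdd ∈ S from h _ (hx i (i.2.trans j.2) (x j)) _
    have hle : closure ((fun k => x k ^ p) '' Set.Iio (i : ℕ)) ≤ W := by
      rw [closure_le]
      rintro _ ⟨k, -, rfl⟩
      exact ⟨x k, rfl⟩
    intro g hg
    induction hg using closure_induction with
    | mem g hg =>
      obtain ⟨k, hk, rfl⟩ := hg
      exact fun _ => Submodule.subset_span ⟨⟨k, hk⟩, rfl⟩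
    | one =>
      intro h1
      have : (⟨1, h1⟩ : W) = 1 := rfl
      rw [this, map_one]
      exact S.zero_mem
    | mul a b ha hb iha ihb =>
      intro hab
      have : (⟨a * b, hab⟩ : W) = ⟨a, hle ha⟩ * ⟨b, hle hb⟩ := rfl
      rw [this, map_mul]
      exact S.add_mem (iha _) (ihb _)
    | inv a ha iha =>
      intro hia
      have : (⟨a⁻¹, hia⟩ : W) = (⟨a, hle ha⟩ : W)⁻¹ := rfl
      rw [this, map_inv]
      exact S.neg_mem (iha _)

/-! ### The upper bound -/

/-- The number of triples `k < i < j < r` with `k < s`, written as the sum of `min i s` over the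
pairs `i < j < r`. It is the dimension of the space of triangular structure constants. -/
def numTriples (r s : ℕ) : ℕ := ∑ j ∈ Finset.range r, ∑ i ∈ Finset.range j, min i s

theorem prod_prod_pow_min (p r s : ℕ) :
    ∏ j : Fin r, ∏ i : Fin j, p ^ min (i : ℕ) s = p ^ numTriples r s := by
  simp_rw [Finset.prod_pow_eq_pow_sum]
  rw [numTriples, ← Fin.sum_univ_eq_sum_range (fun j => ∑ i ∈ Finset.range j, min i s)]
  congr 1
  exact Finset.sum_congr rfl fun j _ => Fin.sum_univ_eq_sum_range (fun i => min i s) j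

/-- Triangular structure constants: vectors `P i` in `𝔽_p ^ s`, for `i < r`, and for `i < j < r` a
vector in the span of the `P k` with `k < i`. -/
def Code (p r s : ℕ) : Type :=
  Σ P : Fin r → Fin s → ZMod p, (j : Fin r) → (i : Fin j) →
    Submodule.span (ZMod p) (Set.range fun k : Fin (i : ℕ) => P ⟨k, k.2.trans (i.2.trans j.2)⟩)

theorem finite_code {p : ℕ} (hp : p.Prime) (r s : ℕ) : Finite (Code p r s) := by
  have : NeZero p := ⟨hp.ne_zero⟩
  unfold Code
  infer_instance

theorem card_code_le {p : ℕ} (hp : p.Prime) (r s : ℕ) :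
    Nat.card (Code p r s) ≤ p ^ (r * s + numTriples r s) := by
  have : Fact p.Prime := ⟨hp⟩
  have h : ∀ P : Fin r → Fin s → ZMod p, Nat.card ((j : Fin r) → (i : Fin j) →
      Submodule.span (ZMod p) (Set.range fun k : Fin (i : ℕ) =>
        P ⟨k, k.2.trans (i.2.trans j.2)⟩)) ≤ p ^ numTriples r s := by
    intro P
    simp_rw [Nat.card_pi]
    rw [← prod_prod_pow_min]
    refine Finset.prod_le_prod' fun j _ => Finset.prod_le_prod' fun i _ => ?_
    rw [Module.natCard_eq_pow_finrank (K := ZMod p), Nat.card_zmod]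
    refine Nat.pow_le_pow_right hp.pos (le_min ?_ ?_)
    -- The span has dimension at most `i`, by its generators, and at most `s`, by the ambient space.
    · simpa [Set.finrank] using finrank_range_le_card (R := ZMod p)
        (fun k : Fin (i : ℕ) => P ⟨k, k.2.trans (i.2.trans j.2)⟩)
    · simpa using Submodule.finrank_le (Submodule.span (ZMod p) (Set.range fun k : Fin (i : ℕ) =>
        P ⟨k, k.2.trans (i.2.trans j.2)⟩))
  unfold Code
  rw [Nat.card_sigma]
  refine (Finset.sum_le_card_nsmul _ _ _ fun P _ => h P).trans ?_
  simp [pow_add, pow_mul', mul_comm]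

/-- The group `G` is generated by a realization of the triangular structure constants `c.2`, where
`c.1` is the dimension `s` of the subgroup of `p`-th powers and `n - s` the number of generators. -/
def HasCode {p n : ℕ} (G : Type*) [Group G] (c : Σ s : Fin (n / 2 + 1), Code p (n - s) s) : Prop :=
  ∃ (x : Fin (n - c.1) → G) (ω : Multiplicative (Fin c.1 → ZMod p) →* G),
    Realizes p c.2.1 (fun j i => (c.2.2 j i : Fin c.1 → ZMod p)) x ω ∧
      Subgroup.closure (Set.range x) ⊔ ω.range = ⊤

theorem exists_hasCode {p n : ℕ} (hp : p.Prime) (hodd : Odd p) {G : Type*} [Group G]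
    (hcard : Nat.card G = p ^ n) (hG : IsPowerfullyNilpotent p G)
    (hexp : Monoid.exponent G = p ^ 2) :
    ∃ c : (Σ s : Fin (n / 2 + 1), Code p (n - s) s), HasCode G c := by
  obtain ⟨s, hs, P, C, x, ω, h1, h2, h3⟩ := exists_realizes hp hodd hcard hG hexp
  exact ⟨⟨⟨s, by omega⟩, P, fun j i => ⟨C j i, h3 j i⟩⟩, x, ω, h1, h2⟩

theorem HasCode.nonempty_mulEquiv {p n : ℕ} (hp : p.Prime) {G G' : Type*} [Group G] [Group G']
    (hG : Nat.card G = p ^ n) (hG' : Nat.card G' = p ^ n)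
    {c : Σ s : Fin (n / 2 + 1), Code p (n - s) s} (h : HasCode G c) (h' : HasCode G' c) :
    Nonempty (G ≃* G') := by
  obtain ⟨x, ω, h1, h2⟩ := h
  obtain ⟨x', ω', h1', h2'⟩ := h'
  have hn : n - c.1 + c.1 = n := by
    have := c.1.2
    omega
  exact h1.nonempty_mulEquiv hp h1' h2 h2' (by rw [hn, hG]) (by rw [hn, hG'])

/-- The upper bound: triangular structure constants determine the group. -/
theorem finite_quotient_and_numPN_le {p : ℕ} (hp : p.Prime) (hodd : Odd p) (n : ℕ) :
    Finite (Quotient (pnSetoid p n)) ∧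
    numPN p n ≤ ∑ s ∈ Finset.range (n / 2 + 1), p ^ ((n - s) * s + numTriples (n - s) s) := by
  have hcard : Nat.card (Fin (p ^ n)) = p ^ n := Nat.card_fin _
  choose f hf using fun q : Quotient (pnSetoid p n) =>
    @exists_hasCode p n hp hodd _ q.out.1 hcard q.out.2.1 q.out.2.2
  have hinj : Function.Injective f := by
    intro q q' hqq
    have hq' := hf q'
    rw [← hqq] at hq'
    rw [← Quotient.out_eq q, ← Quotient.out_eq q']
    exact Quotient.sound
      (@HasCode.nonempty_mulEquiv p n hp _ _ q.out.1 q'.out.1 hcard hcard _ (hf q) hq')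
  have := fun s : Fin (n / 2 + 1) => finite_code hp (n - s) s
  refine ⟨Finite.of_injective f hinj, (Nat.card_le_card_of_injective f hinj).trans ?_⟩
  rw [Nat.card_sigma, ← Fin.sum_univ_eq_sum_range
    (fun s => p ^ ((n - s) * s + numTriples (n - s) s))]
  exact Finset.sum_le_sum fun s _ => card_code_le hp _ _

/-! ### Groups with prescribed structure constants -/

section Twist

variable {A : Type*} [AddCommGroup A] (β : A →+ A →+ A)

/-- The group structure `a * b = a + b + β a b` on an abelian group `A`, for a biadditive map `β`
whose values lie in both of its kernels. -/
abbrev twistGroup (hl : ∀ a b c, β (β a b) c = 0) (hr : ∀ a b c, β a (β b c) = 0) : Group A :=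
  letI : Mul A := ⟨fun a b => a + b + β a b⟩
  letI : One A := ⟨0⟩
  letI : Inv A := ⟨fun a => -a + β a a⟩
  Group.ofLeftAxioms
    (fun a b c => by
      change (a + b + β a b) + c + β (a + b + β a b) c = a + (b + c + β b c) + β a (b + c + β b c)
      simp only [map_add, AddMonoidHom.add_apply, hl, hr]
      abel)
    (fun a => by
      change 0 + a + β 0 a = a
      simp)
    (fun a => by
      change (-a + β a a) + a + β (-a + β a a) a = 0
      simp only [map_add, map_neg, AddMonoidHom.add_apply, AddMonoidHom.neg_apply, hl]
      abel)

variable {β} (hl : ∀ a b c, β (β a b) c = 0) (hr : ∀ a b c, β a (β b c) = 0)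

theorem twistGroup_mul (a b : A) :
    letI := twistGroup β hl hr
    a * b = a + b + β a b := rfl

theorem twistGroup_one :
    letI := twistGroup β hl hr
    (1 : A) = 0 := rfl

theorem twistGroup_pow (a : A) (k : ℕ) :
    letI := twistGroup β hl hr
    a ^ k = k • a + k.choose 2 • β a a := by
  let _ := twistGroup β hl hr
  change a ^ k = k • a + k.choose 2 • β a a
  induction k with
  | zero => simpa using twistGroup_one hl hr
  | succ k ih =>
    have h2 : (k + 1).choose 2 = k.choose 2 + k := by
      rw [Nat.choose_succ_succ' k 1, Nat.choose_one_right, add_comm]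
    rw [pow_succ, ih, twistGroup_mul, h2]
    simp only [map_add, map_nsmul, AddMonoidHom.add_apply, AddMonoidHom.nsmul_apply, hl, smul_zero,
      add_smul, one_smul]
    abel

theorem twistGroup_commutatorElement (a b : A) :
    letI := twistGroup β hl hr
    ⁅a, b⁆ = β a b - β b a := by
  let _ := twistGroup β hl hr
  change ⁅a, b⁆ = β a b - β b a
  have h : ⁅a, b⁆ * (b * a) = (β a b - β b a) * (b * a) := by
    have : ⁅a, b⁆ * (b * a) = a * b := by rw [commutatorElement_def]; group
    rw [this]
    simp only [twistGroup_mul, map_add, map_sub, AddMonoidHom.sub_apply, hl]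
    abel
  exact mul_right_cancel h

end Twist

section Form

variable {p r s : ℕ}

/-- Triangular constants, given as the coordinates of index `k < i` of the vectors `C j i`, extended
by zero. -/
def extendConstants (c : (j : Fin r) → (i : Fin j) → Fin (min (i : ℕ) s) → ZMod p)
    (j : Fin r) (i : Fin j) (k : Fin s) : ZMod p :=
  if h : (k : ℕ) < i then c j i ⟨k, lt_min h k.2⟩ else 0

theorem extendConstants_injective :
    Function.Injective (extendConstants (p := p) (r := r) (s := s)) := by
  intro c c' h
  funext j i k
  have h1 := congrFun (congrFun (congrFun h j) i) ⟨k, k.2.trans_le (min_le_right _ _)⟩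
  have hk : (k : ℕ) < i := k.2.trans_le (min_le_left _ _)
  simpa [extendConstants, hk] using h1

/-- The bilinear map with `structureForm C (e i) (e j) = C j i` for `i < j` on the standard basis, and
zero on the other pairs of basis vectors. -/
def structureForm (C : (j : Fin r) → Fin j → Fin s → ZMod p) (u v : Fin r → ZMod p) :
    Fin s → ZMod p :=
  fun k => ∑ j : Fin r, ∑ i : Fin j, C j i k * u ⟨i, i.2.trans j.2⟩ * v j

theorem structureForm_add_left (C : (j : Fin r) → Fin j → Fin s → ZMod p)
    (u u' v : Fin r → ZMod p) :
    structureForm C (u + u') v = structureForm C u v + structureForm C u' v := by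
  funext k
  simp [structureForm, mul_add, add_mul, Finset.sum_add_distrib]

theorem structureForm_add_right (C : (j : Fin r) → Fin j → Fin s → ZMod p)
    (u v v' : Fin r → ZMod p) :
    structureForm C u (v + v') = structureForm C u v + structureForm C u v' := by
  funext k
  simp [structureForm, mul_add, Finset.sum_add_distrib]

theorem structureForm_zero_left (C : (j : Fin r) → Fin j → Fin s → ZMod p)
    (v : Fin r → ZMod p) : structureForm C 0 v = 0 := by
  funext k
  simp [structureForm]

theorem structureForm_zero_right (C : (j : Fin r) → Fin j → Fin s → ZMod p)
    (u : Fin r → ZMod p) : structureForm C u 0 = 0 := by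
  funext k
  simp [structureForm]

theorem structureForm_single_of_lt (C : (j : Fin r) → Fin j → Fin s → ZMod p) (j : Fin r)
    (i : Fin j) :
    structureForm C (Pi.single ⟨i, i.2.trans j.2⟩ 1) (Pi.single j 1) = C j i := by
  funext k
  rw [structureForm, Finset.sum_eq_single j, Finset.sum_eq_single i]
  · simp
  · intro i' _ hi
    have : (⟨i', i'.2.trans j.2⟩ : Fin r) ≠ ⟨i, i.2.trans j.2⟩ := fun h =>
      hi (Fin.ext (Fin.mk.inj_iff.1 h))
    simp [Pi.single_eq_of_ne this]
  · simp
  · intro j' _ hj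
    simp [Pi.single_eq_of_ne hj]
  · simp

theorem structureForm_single_of_gt (C : (j : Fin r) → Fin j → Fin s → ZMod p) (j : Fin r)
    (i : Fin j) :
    structureForm C (Pi.single j 1) (Pi.single ⟨i, i.2.trans j.2⟩ 1) = 0 := by
  funext k
  refine Finset.sum_eq_zero fun j' _ => Finset.sum_eq_zero fun i' _ => ?_
  by_cases hj : j' = ⟨i, i.2.trans j.2⟩
  · have : (⟨i', i'.2.trans j'.2⟩ : Fin r) ≠ j := by
      intro h
      have h1 : (i' : ℕ) = j := congrArg Fin.val h
      have h2 : (j' : ℕ) = i := congrArg Fin.val hj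
      have := i'.2
      have := i.2
      omega
    simp [Pi.single_eq_of_ne this]
  · simp [Pi.single_eq_of_ne hj]

/-- If `u` lies in the span of the first `l + 1` basis vectors, then the values at `u` of the form of
triangular constants involve only the coordinates of index `k < l`: a contribution of `C j i` at `k`
needs `k < i < j` and one of `i`, `j` at most `l`. -/
theorem structureForm_apply_eq_zero
    (c : (j : Fin r) → (i : Fin j) → Fin (min (i : ℕ) s) → ZMod p) {l : ℕ}
    {u : Fin r → ZMod p} (hu : ∀ j : Fin r, l + 1 ≤ j → u j = 0) (v : Fin r → ZMod p) {k : Fin s}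
    (hk : l ≤ k) :
    structureForm (extendConstants c) u v k = 0 ∧ structureForm (extendConstants c) v u k = 0 := by
  constructor <;> refine Finset.sum_eq_zero fun j _ => Finset.sum_eq_zero fun i _ => ?_
  · by_cases h : (k : ℕ) < i
    · rw [hu ⟨i, i.2.trans j.2⟩ (by simp; omega)]; simp
    · simp [extendConstants, h]
  · by_cases h : (k : ℕ) < i
    · rw [hu j (by have := i.2; omega)]; simp
    · simp [extendConstants, h]

/-- The vectors `P i` for which `P i` is the standard basis vector of index `i` if `i < s`, and zero
otherwise. -/
def unitPowers (p r s : ℕ) (i : Fin r) (k : Fin s) : ZMod p := if (i : ℕ) = k then 1 else 0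

/-- Every family of triangular constants `c` is realized by a powerfully nilpotent group of exponent
`p ^ 2`. On an abelian group `A` on which multiplication by `p` is the composite of a reduction `ρ`
onto `𝔽_p ^ r`, the projection to the first `s` coordinates, and an embedding `ι` of `𝔽_p ^ s`, the
group structure is twisted by `β a b = ι (structureForm (extendConstants c) (ρ a) (ρ b))`. -/
theorem exists_twisted_group (hp : p.Prime) (hodd : Odd p) (hs : 1 ≤ s) (hsr : s ≤ r)
    {A : Type*} [AddCommGroup A] (hcard : Nat.card A = p ^ (r + s))
    (ρ : A →+ (Fin r → ZMod p)) (ι : (Fin s → ZMod p) →+ A) (hρ : Function.Surjective ρ)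
    (hι : Function.Injective ι) (hρι : ∀ w, ρ (ι w) = 0)
    (hpA : ∀ a, p • a = ι fun k => ρ a (Fin.castLE hsr k))
    (c : (j : Fin r) → (i : Fin j) → Fin (min (i : ℕ) s) → ZMod p) :
    ∃ _ : Group A, IsPowerfullyNilpotent p A ∧ Monoid.exponent A = p ^ 2 ∧
      ∃ (x : Fin r → A) (ω : Multiplicative (Fin s → ZMod p) →* A),
        Realizes p (unitPowers p r s) (extendConstants c) x ω := by
  have : Fact p.Prime := ⟨hp⟩
  have hfin : Finite A := Nat.finite_of_card_ne_zero (by rw [hcard]; exact pow_ne_zero _ hp.ne_zero)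
  set B := structureForm (extendConstants c) with hB
  let β : A →+ A →+ A := AddMonoidHom.mk' (fun a => AddMonoidHom.mk' (fun b => ι (B (ρ a) (ρ b)))
    (fun b b' => by rw [map_add, hB, structureForm_add_right, map_add]))
    (fun a a' => by
      ext b
      simp [hB, structureForm_add_left])
  have hβ : ∀ a b, β a b = ι (B (ρ a) (ρ b)) := fun _ _ => rfl
  have hιl : ∀ w b, β (ι w) b = 0 := fun w b => by
    rw [hβ, hρι, hB, structureForm_zero_left, map_zero]
  have hιr : ∀ a w, β a (ι w) = 0 := fun a w => by
    rw [hβ, hρι, hB, structureForm_zero_right, map_zero]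
  have hl : ∀ a b c, β (β a b) c = 0 := fun a b c => hιl _ _
  have hr : ∀ a b c, β a (β b c) = 0 := fun a b c => hιr _ _
  let _ := twistGroup β hl hr
  have hmul : ∀ a b : A, a * b = a + b + β a b := twistGroup_mul hl hr
  have hone : (1 : A) = 0 := rfl
  have hcomm : ∀ a b : A, ⁅a, b⁆ = ι (B (ρ a) (ρ b) - B (ρ b) (ρ a)) := fun a b => by
    rw [map_sub]
    exact twistGroup_commutatorElement hl hr a b
  have hρm : ∀ a b : A, ρ (a * b) = ρ a + ρ b := fun a b => by
    rw [hmul, map_add, map_add, hβ, hρι, add_zero]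
  have hpow : ∀ a : A, a ^ p = ι fun k => ρ a (Fin.castLE hsr k) := by
    intro a
    have h2p : 2 < p := lt_of_le_of_ne hp.two_le (by rintro rfl; exact absurd hodd (by decide))
    obtain ⟨k, hk⟩ := hp.dvd_choose_self (k := 2) (by norm_num) h2p
    have h0 : p • β a a = 0 := by
      rw [hpA, hβ, hρι]
      exact map_zero ι
    have h1 : a ^ p = p • a + p.choose 2 • β a a := twistGroup_pow hl hr a p
    rw [h1, hk, mul_comm, mul_smul, h0, smul_zero, add_zero, hpA]
  have hpp : ∀ a : A, a ^ p ^ 2 = 1 := by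
    intro a
    rw [pow_two, pow_mul, hpow, hpow, hρι]
    exact map_zero ι
  choose x hx using fun i : Fin r => hρ (Pi.single i 1)
  -- The chain consists of `⊥` and the preimages under `ρ` of the standard flag.
  let K : ℕ → Subgroup A := fun l =>
    { carrier := {a | ∀ j : Fin r, l ≤ j → ρ a j = 0}
      mul_mem' := fun {a b} ha hb j hj => by rw [hρm, Pi.add_apply, ha j hj, hb j hj, add_zero]
      one_mem' := fun j _ => by rw [hone, map_zero]; rfl
      inv_mem' := fun {a} ha j hj => by
        have h := hρm a⁻¹ a
        rw [inv_mul_cancel, hone, map_zero] at h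
        have h1 := congrFun h j
        rw [Pi.add_apply, ha j hj, add_zero] at h1
        exact h1.symm }
  have hK : ∀ l a, a ∈ K l ↔ ∀ j : Fin r, l ≤ j → ρ a j = 0 := fun _ _ => Iff.rfl
  let H : ℕ → Subgroup A := fun l => Nat.casesOn l ⊥ K
  have hH : IsPowerfullyCentralChain p (r + 1) H := by
    rintro (_ | l) -
    · refine ⟨bot_le, commutator_le.2 fun a ha g _ => ?_⟩
      have ha0 : ρ a = 0 := funext fun j => (hK 0 a).1 ha j (Nat.zero_le _)
      rw [hcomm, ha0, hB, structureForm_zero_left, structureForm_zero_right, sub_zero, map_zero]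
      exact one_mem _
    · refine ⟨fun a ha j hj => ha j (by omega), commutator_le.2 fun a ha g _ => ?_⟩
      set w := B (ρ a) (ρ g) - B (ρ g) (ρ a) with hw
      obtain ⟨y, hy⟩ := hρ fun j => if h : (j : ℕ) < s then w ⟨j, h⟩ else 0
      have hyp : ⁅a, g⁆ = y ^ p := by
        rw [hcomm, hpow, hy]
        congr 1
        funext k
        have hk : ((Fin.castLE hsr k : Fin r) : ℕ) < s := k.2
        simp only [dif_pos hk, hw]
        rfl
      rw [hyp]
      refine pow_mem_powSubgroup p ((hK l y).2 fun j hj => ?_)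
      rw [hy]
      dsimp only
      split_ifs with h
      · obtain ⟨h1, h2⟩ := structureForm_apply_eq_zero c ((hK (l + 1) a).1 ha) (ρ g)
          (k := ⟨j, h⟩) hj
        rw [hw, Pi.sub_apply, hB, h1, h2, sub_zero]
      · rfl
  have hHtop : K r = ⊤ := eq_top_iff.2 fun a _ => (hK r a).2 fun j hj => absurd j.2 (by omega)
  refine ⟨_, ⟨⟨hfin, IsPGroup.of_card hcard, ?_⟩, r + 1, H, rfl, hHtop, hH⟩, ?_, x,
    { toFun := fun w => ι w.toAdd
      map_one' := map_zero ι
      map_mul' := fun w w' => by rw [hmul, hιl, add_zero, toAdd_mul, map_add] }, ?_, ?_, ?_, ?_⟩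
  · have hp2 : p ≠ 2 := by rintro rfl; exact absurd hodd (by decide)
    rw [if_neg hp2]
    have h := (hH r (Nat.lt_succ_self r)).2
    change ⁅K r, (⊤ : Subgroup A)⁆ ≤ _ at h
    rw [hHtop] at h
    exact h.trans (powSubgroup_mono p le_top)
  · obtain ⟨k, hk, he⟩ := (Nat.dvd_prime_pow hp).1 (Monoid.exponent_dvd_of_forall_pow_eq_one hpp)
    rw [he]
    congr 1
    by_contra hne
    have hdvd : Monoid.exponent A ∣ p := by
      rw [he]
      exact (pow_dvd_pow p (by omega : k ≤ 1)).trans (pow_one p).dvd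
    have h := Monoid.exponent_dvd_iff_forall_pow_eq_one.1 hdvd (x ⟨0, by omega⟩)
    rw [hpow, hx, hone, ← map_zero ι] at h
    have h1 := congrFun (hι h) ⟨0, hs⟩
    simp at h1
  · intro w g
    change ι w.toAdd * g = g * ι w.toAdd
    rw [hmul, hmul, hιl, hιr, add_comm g]
  · exact fun w w' h => Multiplicative.toAdd.injective (hι h)
  · intro i
    rw [hpow, hx]
    change _ = ι _
    congr 1
    funext k
    simp [unitPowers, Pi.single_apply, Fin.ext_iff, eq_comm]
  · intro j i
    rw [hcomm, hx, hx, hB, structureForm_single_of_lt, structureForm_single_of_gt, sub_zero]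
    rfl

end Form

/-! ### The lower bound -/

theorem map_powSubgroup {G G' : Type*} [Group G] [Group G'] (f : G →* G') (H : Subgroup G)
    (m : ℕ) : (powSubgroup H m).map f = powSubgroup (H.map f) m := by
  rw [powSubgroup, powSubgroup, MonoidHom.map_closure]
  congr 1
  ext g
  constructor
  · rintro ⟨_, ⟨x, hx, rfl⟩, rfl⟩
    exact ⟨f x, mem_map_of_mem f hx, map_pow f x m⟩
  · rintro ⟨_, ⟨x, hx, rfl⟩, rfl⟩
    exact ⟨x ^ m, ⟨x, hx, rfl⟩, map_pow f x m⟩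

theorem IsPowerfullyNilpotent.of_mulEquiv {p : ℕ} {G G' : Type*} [Group G] [Group G']
    (e : G ≃* G') (h : IsPowerfullyNilpotent p G) : IsPowerfullyNilpotent p G' := by
  obtain ⟨⟨hfin, hp, hpow⟩, m, H, h0, hm, hH⟩ := h
  have htop : (⊤ : Subgroup G).map e.toMonoidHom = ⊤ := map_top_of_surjective _ e.surjective
  refine ⟨⟨Finite.of_equiv G e.toEquiv, hp.of_equiv e, ?_⟩, m, fun i => (H i).map e.toMonoidHom,
    ?_, ?_, fun i hi => ⟨map_mono (hH i hi).1, ?_⟩⟩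
  · rw [← htop, ← map_commutator, ← map_powSubgroup]
    exact map_mono hpow
  · simp [h0]
  · simp only [hm, htop]
  · rw [← htop, ← map_commutator, ← map_powSubgroup]
    exact map_mono (hH i hi).2

/-- The abelian group `(ℤ/p²) ^ s × (ℤ/p) ^ (r - s)`, with its reduction modulo `p` and the embedding
of `𝔽_p ^ s` as the multiples of `p`. -/
theorem exists_abelian_coordinates {p r s : ℕ} (hp : p.Prime) (hsr : s ≤ r) :
    ∃ (A : Type) (_ : AddCommGroup A) (ρ : A →+ (Fin r → ZMod p)) (ι : (Fin s → ZMod p) →+ A),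
      Nat.card A = p ^ (r + s) ∧ Function.Surjective ρ ∧ Function.Injective ι ∧
      (∀ w, ρ (ι w) = 0) ∧ ∀ a, p • a = ι fun k => ρ a (Fin.castLE hsr k) := by
  obtain ⟨t, rfl⟩ := Nat.exists_eq_add_of_le hsr
  have : NeZero p := ⟨hp.ne_zero⟩
  have hdvd : p ∣ p ^ 2 := dvd_pow_self p two_ne_zero
  -- Reduction modulo `p`, and multiplication by `p` as a map from `ℤ/p` to `ℤ/p²`.
  let red : ZMod (p ^ 2) →+ ZMod p := (ZMod.castHom hdvd (ZMod p)).toAddMonoidHom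
  have hpp : (p : ZMod (p ^ 2)) * p = 0 := by
    rw [← Nat.cast_mul, ← pow_two, ZMod.natCast_self]
  let ver : ZMod p →+ ZMod (p ^ 2) :=
    ZMod.lift p ⟨zmultiplesHom _ (p : ZMod (p ^ 2)), by simp [hpp]⟩
  have hver : ∀ m : ℤ, ver m = m * p := fun m => by simp [ver]
  have hredver : ∀ y, red (ver y) = 0 := fun y => by
    obtain ⟨m, rfl⟩ := ZMod.intCast_surjective y
    rw [hver]
    simp [red]
  have hverred : ∀ y, ver (red y) = p • y := fun y => by
    obtain ⟨m, rfl⟩ := ZMod.intCast_surjective y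
    have : red (m : ZMod (p ^ 2)) = m := by simp [red]
    rw [this, hver, nsmul_eq_mul, mul_comm]
  have hverinj : Function.Injective ver := by
    rw [injective_iff_map_eq_zero]
    intro y hy
    obtain ⟨m, rfl⟩ := ZMod.intCast_surjective y
    rw [hver] at hy
    have h1 : ((m * p : ℤ) : ZMod (p ^ 2)) = 0 := by push_cast; exact hy
    rw [ZMod.intCast_zmod_eq_zero_iff_dvd] at h1
    rw [ZMod.intCast_zmod_eq_zero_iff_dvd]
    push_cast [pow_two] at h1
    exact Int.dvd_of_mul_dvd_mul_right (by exact_mod_cast hp.ne_zero) h1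
  have hredsurj : Function.Surjective red := ZMod.castHom_surjective hdvd
  refine ⟨(Fin s → ZMod (p ^ 2)) × (Fin t → ZMod p), inferInstance,
    { toFun := fun a => Fin.append (fun k => red (a.1 k)) a.2
      map_zero' := ?_
      map_add' := ?_ },
    { toFun := fun w => (fun k => ver (w k), 0)
      map_zero' := ?_
      map_add' := ?_ }, ?_, ?_, ?_, ?_, ?_⟩
  · funext i
    refine Fin.addCases (fun i => ?_) (fun i => ?_) i <;> simp
  · intro a b
    funext i
    refine Fin.addCases (fun i => ?_) (fun i => ?_) i <;> simp
  · ext <;> simp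
  · intro a b
    ext <;> simp
  · simp [← pow_mul, ← pow_add]
    ring_nf
  · intro u
    choose g hg using hredsurj
    refine ⟨(fun k => g (u (Fin.castAdd t k)), fun k => u (Fin.natAdd s k)), ?_⟩
    funext i
    refine Fin.addCases (fun i => ?_) (fun i => ?_) i <;> simp [hg]
  · intro w w' h
    funext k
    exact hverinj (congrFun (congrArg Prod.fst h) k)
  · intro w
    funext i
    refine Fin.addCases (fun i => ?_) (fun i => ?_) i <;> simp [hredver]
  · intro a
    refine Prod.ext (funext fun k => ?_) (funext fun k => ?_)
    · simp [hverred]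
    · simp

/-- The tuple `x` alone determines the commutator constants when the powers are the unit vectors, as
then `ω` is determined by the elements `x k ^ p` with `k < s`. -/
theorem Realizes.constants_unique {p r s : ℕ} (hp : p.Prime) (hsr : s ≤ r)
    {C C' : (j : Fin r) → Fin j → Fin s → ZMod p} {G : Type*} [Group G] {x : Fin r → G}
    {ω ω' : Multiplicative (Fin s → ZMod p) →* G} (h : Realizes p (unitPowers p r s) C x ω)
    (h' : Realizes p (unitPowers p r s) C' x ω') : C = C' := by
  have : NeZero p := ⟨hp.ne_zero⟩
  have hω : ∀ w : Fin s → ZMod p, ω (.ofAdd w) = ω' (.ofAdd w) := by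
    intro w
    induction w using Pi.single_induction with
    | zero => rw [ofAdd_zero, map_one, map_one]
    | add f g hf hg => rw [ofAdd_add, map_mul, map_mul, hf, hg]
    | single k y =>
      obtain ⟨m, rfl⟩ := ZMod.natCast_zmod_surjective y
      have h1 : Pi.single k (m : ZMod p) = m • (Pi.single k 1 : Fin s → ZMod p) := by
        rw [← Pi.single_smul, nsmul_one]
      have h2 : (Pi.single k 1 : Fin s → ZMod p) = unitPowers p r s (Fin.castLE hsr k) := by
        funext l
        simp [unitPowers, Pi.single_apply, Fin.ext_iff, eq_comm]
      rw [h1, ofAdd_nsmul, map_pow, map_pow, h2, ← h.pow_eq, ← h'.pow_eq]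
  funext j i
  apply Multiplicative.ofAdd.injective
  apply h'.injective
  rw [← h'.commutator_eq, ← hω, h.commutator_eq]

/-- Transport of a realization along a bijection of the underlying sets. -/
theorem exists_group_of_equiv {p r s : ℕ} {P : Fin r → Fin s → ZMod p}
    {C : (j : Fin r) → Fin j → Fin s → ZMod p} {A A' : Type*} [Group A] (e : A ≃ A')
    (hA : IsPowerfullyNilpotent p A) (hexp : Monoid.exponent A = p ^ 2) {x : Fin r → A}
    {ω : Multiplicative (Fin s → ZMod p) →* A} (h : Realizes p P C x ω) :
    ∃ _ : Group A', IsPowerfullyNilpotent p A' ∧ Monoid.exponent A' = p ^ 2 ∧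
      ∃ (x : Fin r → A') (ω : Multiplicative (Fin s → ZMod p) →* A'), Realizes p P C x ω := by
  let _ : Group A' := e.symm.group
  let e' : A ≃* A' := e.symm.mulEquiv.symm
  exact ⟨_, hA.of_mulEquiv e', (Monoid.exponent_eq_of_mulEquiv e').symm.trans hexp, _, _,
    h.map e'⟩

/-- The lower bound: triangular constants `c` are determined by the isomorphism class that they
define, together with the images of the `r` generators in a representative of this class. -/
theorem pow_numTriples_le {p r s : ℕ} (hp : p.Prime) (hodd : Odd p) (hs : 1 ≤ s) (hsr : s ≤ r) :
    p ^ numTriples r s ≤ numPN p (r + s) * (p ^ (r + s)) ^ r := by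
  have : NeZero p := ⟨hp.ne_zero⟩
  obtain ⟨A, _, ρ, ι, hcard, hρ, hι, hρι, hpA⟩ := exists_abelian_coordinates hp hsr
  have hfin : Finite A := Nat.finite_of_card_ne_zero (by rw [hcard]; exact pow_ne_zero _ hp.ne_zero)
  let e : A ≃ Fin (p ^ (r + s)) := Nat.equivFinOfCardPos (by
    rw [hcard]; exact pow_ne_zero _ hp.ne_zero) |>.trans (finCongr hcard)
  have key : ∀ c : (j : Fin r) → (i : Fin j) → Fin (min (i : ℕ) s) → ZMod p,
      ∃ (q : Quotient (pnSetoid p (r + s))) (x : Fin r → Fin (p ^ (r + s)))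
        (ω : letI := q.out.1; Multiplicative (Fin s → ZMod p) →* Fin (p ^ (r + s))),
        @Realizes p r s (unitPowers p r s) (extendConstants c) _ q.out.1 x ω := by
    intro c
    obtain ⟨_, h1, h2, x, ω, h3⟩ :=
      exists_twisted_group hp hodd hs hsr hcard ρ ι hρ hι hρι hpA c
    obtain ⟨S, h1, h2, x, ω, h3⟩ := exists_group_of_equiv e h1 h2 h3
    let T : PNStructure p (r + s) := ⟨S, h1, h2⟩
    obtain ⟨f⟩ : Nonempty
        (@MulEquiv _ _ T.1.toMul (Quotient.out ⟦T⟧ : PNStructure p (r + s)).1.toMul) :=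
      (pnSetoid p (r + s)).symm (Quotient.mk_out (s := pnSetoid p (r + s)) T)
    exact ⟨⟦T⟧, _, _, @Realizes.map _ _ _ _ _ _ _ S (Quotient.out ⟦T⟧ : PNStructure p (r + s)).1 _ _
      h3 f⟩
  choose q x ω hq using key
  have hinj : Function.Injective fun c => (q c, x c) := by
    intro c c' h
    have h1 : q c = q c' := congrArg Prod.fst h
    have h2 : x c = x c' := congrArg Prod.snd h
    have hc := hq c
    have hc' := hq c'
    revert hc hc'
    generalize ω c = w
    generalize ω c' = w'
    revert w w'
    rw [← h1, ← h2]
    intro w w' hc hc'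
    apply extendConstants_injective
    exact @Realizes.constants_unique _ _ _ hp hsr _ _ _ (q c).out.1 _ _ _ hc hc'
  have hF := (finite_quotient_and_numPN_le hp hodd (r + s)).1
  have := Nat.card_le_card_of_injective _ hinj
  rw [Nat.card_prod] at this
  have hL : Nat.card ((j : Fin r) → (i : Fin j) → Fin (min (i : ℕ) s) → ZMod p) =
      p ^ numTriples r s := by
    rw [← prod_prod_pow_min]
    simp
  rw [hL] at this
  refine this.trans (le_of_eq ?_)
  simp [numPN]

end Groups

/-! ### Maximizing the number of structure constants -/

theorem sum_range_min_add_choose (j s : ℕ) :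
    ∑ i ∈ Finset.range j, min i s + (j - s).choose 2 = j.choose 2 := by
  induction j with
  | zero => simp
  | succ j ih =>
    rw [Finset.sum_range_succ, Nat.choose_succ_succ' j 1, Nat.choose_one_right, ← ih]
    rcases le_total s j with h | h
    · rw [Nat.succ_sub h, Nat.choose_succ_succ' (j - s) 1, Nat.choose_one_right, min_eq_right h]
      simp only [Nat.reduceAdd]
      omega
    · have h1 : (j + 1 - s).choose 2 = 0 := Nat.choose_eq_zero_of_lt (by omega)
      have h2 : (j - s).choose 2 = 0 := Nat.choose_eq_zero_of_lt (by omega)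
      rw [h1, h2, min_eq_left h]
      omega

theorem numTriples_add_choose (r s : ℕ) : numTriples r s + (r - s).choose 3 = r.choose 3 := by
  unfold numTriples
  induction r with
  | zero => simp
  | succ r ih =>
    rw [Finset.sum_range_succ, Nat.choose_succ_succ' r 2, ← ih, ← sum_range_min_add_choose r s]
    rcases le_total s r with h | h
    · rw [Nat.succ_sub h, Nat.choose_succ_succ' (r - s) 2]
      simp only [Nat.reduceAdd]
      omega
    · have h1 : (r + 1 - s).choose 3 = 0 := Nat.choose_eq_zero_of_lt (by omega)
      have h2 : (r - s).choose 3 = 0 := Nat.choose_eq_zero_of_lt (by omega)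
      have h3 : (r - s).choose 2 = 0 := Nat.choose_eq_zero_of_lt (by omega)
      rw [h1, h2, h3]
      omega

theorem six_mul_choose_three (n : ℕ) :
    6 * (n.choose 3 : ℝ) = n * (n - 1) * (n - 2) := by
  induction n with
  | zero => simp
  | succ n ih =>
    rw [Nat.choose_succ_succ' n 2]
    push_cast
    rw [mul_add, ih, Nat.cast_choose_two]
    ring

theorem six_mul_numTriples {n s : ℕ} (h : 2 * s ≤ n) :
    6 * (numTriples (n - s) s : ℝ) = ((n : ℝ) - s) * (n - s - 1) * (n - s - 2) -
      ((n : ℝ) - 2 * s) * (n - 2 * s - 1) * (n - 2 * s - 2) := by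
  have h1 : (numTriples (n - s) s : ℝ) + ((n - s - s).choose 3 : ℕ) = ((n - s).choose 3 : ℕ) := by
    exact_mod_cast numTriples_add_choose (n - s) s
  have h2 : ((n - s : ℕ) : ℝ) = n - s := Nat.cast_sub (by omega)
  have h3 : ((n - s - s : ℕ) : ℝ) = n - 2 * s := by
    rw [Nat.cast_sub (by omega), h2]; ring
  have h4 := six_mul_choose_three (n - s)
  have h5 := six_mul_choose_three (n - s - s)
  rw [h2] at h4
  rw [h3] at h5
  linarith

/-- With `σ = (3 - √2) / 7`, the cubic `(n - s) ^ 3 - (n - 2 * s) ^ 3` in `s` has a local maximum at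
`s = σ * n`, whence the double root; the other factor is positive in the range `2 * s ≤ n`. -/
theorem growth_identity (n s : ℝ) :
    (9 + 4 * √2) / 49 * n ^ 3 - ((n - s) ^ 3 - (n - 2 * s) ^ 3) =
      7 * (s - (3 - √2) / 7 * n) ^ 2 * ((3 + 2 * √2) / 7 * n - s) := by
  have h : √2 ^ 2 = 2 := Real.sq_sqrt (by norm_num)
  linear_combination ((9 - 2 * √2) / 49 * n ^ 3 - 3 / 7 * n ^ 2 * s) * h

theorem sqrt_two_bounds : 1.4 < √2 ∧ √2 < 1.5 :=
  ⟨Real.lt_sqrt_of_sq_lt (by norm_num), (Real.sqrt_lt' (by norm_num)).2 (by norm_num)⟩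

theorem numTriples_le {n s : ℕ} (h : 2 * s ≤ n) :
    (numTriples (n - s) s : ℝ) ≤ (9 + 4 * √2) / 294 * (n : ℝ) ^ 3 + (n : ℝ) ^ 2 := by
  have h6 := six_mul_numTriples h
  have hid := growth_identity n s
  obtain ⟨hq, -⟩ := sqrt_two_bounds
  have hs : 2 * (s : ℝ) ≤ n := by exact_mod_cast h
  have hs0 : (0 : ℝ) ≤ s := s.cast_nonneg
  have hn : (n : ℝ) ≤ (n : ℝ) ^ 2 := by exact_mod_cast Nat.le_self_pow two_ne_zero n
  have h1 : 0 ≤ (3 + 2 * √2) / 7 * (n : ℝ) - s := by nlinarith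
  have h2 : 0 ≤ 7 * ((s : ℝ) - (3 - √2) / 7 * n) ^ 2 * ((3 + 2 * √2) / 7 * n - s) := by positivity
  have h3 : ((n : ℝ) - 2 * s) ^ 2 ≤ (n - s) ^ 2 := by
    gcongr
    linarith
  nlinarith

/-- The value `s = ⌊(3 - √2) / 7 * n⌋` attains the maximum up to lower order terms. -/
theorem exists_le_numTriples {n : ℕ} (hn : 10 ≤ n) :
    ∃ s : ℕ, 1 ≤ s ∧ 2 * s ≤ n ∧
      (9 + 4 * √2) / 294 * (n : ℝ) ^ 3 - 2 * (n : ℝ) ^ 2 ≤ numTriples (n - s) s := by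
  obtain ⟨hq, hq'⟩ := sqrt_two_bounds
  have hn' : (10 : ℝ) ≤ n := by exact_mod_cast hn
  have hx : 0 ≤ (3 - √2) / 7 * (n : ℝ) := by
    have : 0 ≤ 3 - √2 := by linarith
    positivity
  refine ⟨⌊(3 - √2) / 7 * (n : ℝ)⌋₊, Nat.le_floor ?_, ?_, ?_⟩
  · push_cast
    nlinarith
  · have h1 := Nat.floor_le hx
    have : (2 * ⌊(3 - √2) / 7 * (n : ℝ)⌋₊ : ℝ) ≤ n := by nlinarith
    exact_mod_cast this
  · have h1 := Nat.floor_le hx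
    have h2 := Nat.lt_floor_add_one ((3 - √2) / 7 * (n : ℝ))
    set s := ⌊(3 - √2) / 7 * (n : ℝ)⌋₊
    have hs : 2 * (s : ℝ) ≤ n := by nlinarith
    have h6 := six_mul_numTriples (n := n) (s := s) (by exact_mod_cast hs)
    have hid := growth_identity n s
    have hs0 : (0 : ℝ) ≤ s := s.cast_nonneg
    have h3 : ((s : ℝ) - (3 - √2) / 7 * n) ^ 2 ≤ 1 := by
      rw [sq_le_one_iff_abs_le_one, abs_le]
      constructor <;> linarith
    have h4 : 0 ≤ (3 + 2 * √2) / 7 * (n : ℝ) - s := by nlinarith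
    have h4' : (3 + 2 * √2) / 7 * (n : ℝ) - s ≤ n := by nlinarith
    have h5 : 7 * ((s : ℝ) - (3 - √2) / 7 * n) ^ 2 * ((3 + 2 * √2) / 7 * n - s) ≤ 7 * n := by
      have := mul_le_mul h3 h4' h4 zero_le_one
      linarith
    have h7 : ((n : ℝ) - s) ^ 2 ≤ n ^ 2 := by gcongr <;> linarith
    nlinarith [sq_nonneg ((n : ℝ) - 2 * s)]

/-- Both counting estimates, with all factors `p ^ O(n ^ 2)` absorbed into the error term. -/
theorem logb_numPN_bounds {p : ℕ} (hp : p.Prime) (hodd : Odd p) {n : ℕ} (hn : 2 ≤ n) :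
    0 < numPN p n ∧
    Real.logb p (numPN p n) ≤ (9 + 4 * √2) / 294 * (n : ℝ) ^ 3 + 3 * (n : ℝ) ^ 2 ∧
    (10 ≤ n → (9 + 4 * √2) / 294 * (n : ℝ) ^ 3 - 3 * (n : ℝ) ^ 2 ≤ Real.logb p (numPN p n)) := by
  have hp1 : (1 : ℝ) < p := by exact_mod_cast hp.one_lt
  have hlow : ∀ s, 1 ≤ s → 2 * s ≤ n → p ^ numTriples (n - s) s ≤ numPN p n * p ^ (n ^ 2) := by
    intro s hs hsn
    have h := pow_numTriples_le (r := n - s) (s := s) hp hodd hs (by omega)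
    rw [Nat.sub_add_cancel (by omega), ← pow_mul] at h
    refine h.trans (Nat.mul_le_mul_left _ (Nat.pow_le_pow_right hp.pos ?_))
    rw [pow_two]
    exact Nat.mul_le_mul_left _ (by omega)
  have hpos : 0 < numPN p n := by
    refine Nat.pos_of_ne_zero fun h0 => ?_
    have := hlow 1 le_rfl (by omega)
    rw [h0, zero_mul] at this
    exact (pow_pos hp.pos _).not_ge this
  have hposR : (0 : ℝ) < numPN p n := by exact_mod_cast hpos
  refine ⟨hpos, ?_, fun h10 => ?_⟩
  · rw [Real.logb_le_iff_le_rpow hp1 hposR]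
    have h1 : (numPN p n : ℝ) ≤
        ∑ s ∈ Finset.range (n / 2 + 1), (p : ℝ) ^ ((n - s) * s + numTriples (n - s) s) := by
      exact_mod_cast (finite_quotient_and_numPN_le hp hodd n).2
    have h2 : ∀ s ∈ Finset.range (n / 2 + 1), (p : ℝ) ^ ((n - s) * s + numTriples (n - s) s) ≤
        (p : ℝ) ^ ((9 + 4 * √2) / 294 * (n : ℝ) ^ 3 + 2 * (n : ℝ) ^ 2) := by
      intro s hs
      have hs' : 2 * s ≤ n := by
        have := Finset.mem_range.1 hs
        omega
      rw [← Real.rpow_natCast]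
      refine Real.rpow_le_rpow_of_exponent_le hp1.le ?_
      have h3 : (((n - s) * s : ℕ) : ℝ) ≤ (n : ℝ) ^ 2 := by
        rw [pow_two]
        exact_mod_cast Nat.mul_le_mul (Nat.sub_le n s) (by omega : s ≤ n)
      have := numTriples_le hs'
      rw [Nat.cast_add]
      linarith
    have h4 : ((n / 2 + 1 : ℕ) : ℝ) ≤ (p : ℝ) ^ ((n : ℝ) ^ 2) := by
      have h5 : n / 2 + 1 ≤ p ^ (n ^ 2) :=
        calc n / 2 + 1 ≤ n := by omega
          _ ≤ n ^ 2 := Nat.le_self_pow two_ne_zero n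
          _ ≤ p ^ n ^ 2 := (Nat.lt_pow_self hp.one_lt).le
      have h6 : ((n : ℝ) ^ 2) = ((n ^ 2 : ℕ) : ℝ) := by push_cast; rfl
      rw [h6, Real.rpow_natCast]
      exact_mod_cast h5
    refine h1.trans ((Finset.sum_le_card_nsmul _ _ _ h2).trans ?_)
    rw [Finset.card_range, nsmul_eq_mul]
    refine (mul_le_mul_of_nonneg_right h4 (by positivity)).trans (le_of_eq ?_)
    rw [← Real.rpow_add (by linarith)]
    congr 1
    ring
  · obtain ⟨s, hs, hsn, hT⟩ := exists_le_numTriples h10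
    rw [Real.le_logb_iff_rpow_le hp1 hposR]
    have h1 : (p : ℝ) ^ (numTriples (n - s) s : ℝ) ≤ numPN p n * (p : ℝ) ^ ((n : ℝ) ^ 2) := by
      have h6 : ((n : ℝ) ^ 2) = ((n ^ 2 : ℕ) : ℝ) := by push_cast; rfl
      rw [h6, Real.rpow_natCast, Real.rpow_natCast]
      exact_mod_cast hlow s hs hsn
    have hpn : 0 < (p : ℝ) ^ ((n : ℝ) ^ 2) := Real.rpow_pos_of_pos (by linarith) _
    rw [← mul_le_mul_iff_left₀ hpn]
    refine le_trans ?_ h1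
    rw [← Real.rpow_add (by linarith)]
    exact Real.rpow_le_rpow_of_exponent_le hp1.le (by linarith)

theorem theorem5p1 (p : ℕ) (hp : p.Prime) (hodd : Odd p) :
    ∃ ε : ℕ → ℝ,
      Asymptotics.IsLittleO Filter.atTop ε (fun n : ℕ => (n : ℝ) ^ 3) ∧
      ∀ n : ℕ, 2 ≤ n →
        (numPN p n : ℝ) = (p : ℝ) ^ ((9 + 4 * Real.sqrt 2) / 294 * (n : ℝ) ^ 3 + ε n) := by
  have hp1 : (1 : ℝ) < p := by exact_mod_cast hp.one_lt
  refine ⟨fun n => Real.logb p (numPN p n) - (9 + 4 * √2) / 294 * (n : ℝ) ^ 3, ?_, fun n hn => ?_⟩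
  · have h1 : (fun n : ℕ => Real.logb p (numPN p n) - (9 + 4 * √2) / 294 * (n : ℝ) ^ 3)
        =O[Filter.atTop] (fun n : ℕ => (n : ℝ) ^ 2) := by
      refine Asymptotics.IsBigO.of_bound 3 ?_
      filter_upwards [Filter.eventually_ge_atTop 10] with n hn
      obtain ⟨-, h2, h3⟩ := logb_numPN_bounds hp hodd (show 2 ≤ n by omega)
      rw [Real.norm_eq_abs, Real.norm_of_nonneg (by positivity), abs_le]
      constructor <;> linarith [h3 hn]
    exact h1.trans_isLittleO ((Asymptotics.isLittleO_pow_pow_atTop_of_lt (𝕜 := ℝ)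
      (show 2 < 3 by norm_num)).comp_tendsto tendsto_natCast_atTop_atTop)
  · have hpos : (0 : ℝ) < numPN p n := by exact_mod_cast (logb_numPN_bounds hp hodd hn).1
    rw [add_sub_cancel, Real.rpow_logb (by linarith) hp1.ne' hpos]
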